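/- Let $H$ be a complex Hilbert space and let $E$ be a bounded idempotent operator on $H$ ($E^2=E$), with associated reflection $C=2E-1$. Let $P_{R(E)}$ and $P_{R(E^*)}$ be the orthogonal projections onto the (closed) ranges of $E$ and $E^*$. Write $|C|=(C^*C)^{1/2}$ and $\pi(C)=C|C|^{-1}$. Writing $E=\begin{pmatrix}1&B\\0&0\end{pmatrix}$ in the decomposition $H=R(E)\oplus R(E)^\perp$ and $T=(1+BB^*)^{1/2}$, the matched projection of $E$ is $$m(E)=\frac12\begin{pmatrix}(T+1)T^{-1}&T^{-1}B\\ B^*T^{-1}&B^*\big(T(T+1)\big)^{-1}B\end{pmatrix}.$$ A geodesic of the manifold $\mathcal P(H)$ of orthogonal projections is a smooth curve $\delta:\mathbb R\to\mathcal P(H)$ along which the covariant derivative of the velocity vanishes, i.e. the $\delta(t)$-codiagonal part $\delta\ddot\delta(1-\delta)+(1-\delta)\ddot\delta\,\delta$ of $\ddot\delta(t)$ is zero for all $t$. Then there is exactly one geodesic $\delta_E$ of $\mathcal P(H)$ with $\delta_E(0)=P_{R(E)}$, $\delta_E(1)=P_{R(E^*)}$ and initial speed $\|\dot\delta_E(0)\|<\pi/2$.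 The operator $\pi(C)$ is unitary and $C=\pi(C)|C|$, i.e. $\pi(C)$ is the unitary part in the polar decomposition of $C$. Finally $$\delta_E(\tfrac12)=m(E)=\tfrac12\big(\pi(C)+1\big),\qquad\text{i.e.}\qquad \tfrac12\big(\pi(C)+1\big)=m\big(\tfrac12(C+1)\big).$$ -/

import Mathlib

open scoped ContDiff InnerProduct

namespace MatchedProjection

noncomputable section

variable {H : Type*} [NormedAddCommGroup H] [InnerProductSpace ℂ H]

/-- The range `R(E)` of a bounded operator `E`, as a linear subspace. -/
abbrev ran (E : H →L[ℂ] H) : Submodule ℂ H := LinearMap.range E.toLinearMap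

/-- The range of a bounded idempotent is closed, hence complete. -/
theorem completeSpace_ran [CompleteSpace H] {E : H →L[ℂ] H} (hE : IsIdempotentElem E) :
    CompleteSpace (ran E) :=
  (ContinuousLinearMap.IsIdempotentElem.isClosed_range hE).completeSpace_coe

/-- The orthogonal projection `P_{R(E)}` onto the range of the idempotent `E`. -/
def rangeProj [CompleteSpace H] (E : H →L[ℂ] H) (hE : IsIdempotentElem E) : H →L[ℂ] H :=
  haveI := completeSpace_ran hE
  (ran E).starProjection

/-! ### The matched projection -/

/-- The operator on `H` with the `2 × 2` matrix `[[a, b], [c, d]]` in the decomposition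
`H = K ⊕ Kᗮ`. -/
def ofBlocks (K : Submodule ℂ H) [K.HasOrthogonalProjection]
    (a : K →L[ℂ] K) (b : Kᗮ →L[ℂ] K) (c : K →L[ℂ] Kᗮ) (d : Kᗮ →L[ℂ] Kᗮ) : H →L[ℂ] H :=
  K.subtypeL ∘L (a ∘L K.orthogonalProjectionOnto + b ∘L Kᗮ.orthogonalProjectionOnto)
    + Kᗮ.subtypeL ∘L (c ∘L K.orthogonalProjectionOnto + d ∘L Kᗮ.orthogonalProjectionOnto)

/-- The upper right entry `Kᗮ → K` of the matrix of `E` in the decomposition `H = K ⊕ Kᗮ`. -/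
def upperRight (K : Submodule ℂ H) [K.HasOrthogonalProjection] (E : H →L[ℂ] H) : Kᗮ →L[ℂ] K :=
  K.orthogonalProjectionOnto ∘L E ∘L Kᗮ.subtypeL

/-- The positive square root of a positive bounded operator `A` on a Hilbert space. -/
def posSqrt {V : Type*} [NormedAddCommGroup V] [InnerProductSpace ℂ V] [CompleteSpace V]
    (A : V →L[ℂ] V) : V →L[ℂ] V :=
  CFC.sqrt A

/-- The operator `T = (1 + B B*)^{1/2}` on `K`, for a bounded operator `B : Kᗮ → K`. -/
def rootT (K : Submodule ℂ H) [CompleteSpace H] [CompleteSpace K] (B : Kᗮ →L[ℂ] K) : K →L[ℂ] K :=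
  posSqrt (1 + B ∘L B†)

/-- The matrix `½ [[(T + 1) T⁻¹, T⁻¹ B], [B* T⁻¹, B* (T (T + 1))⁻¹ B]]`, `T = (1 + B B*)^{1/2}`,
in the decomposition `H = K ⊕ Kᗮ`. The operators `T` and `T (T + 1)` are invertible, as `T ≥ 1`. -/
def matchedBlocks (K : Submodule ℂ H) [CompleteSpace H] [CompleteSpace K]
    (B : Kᗮ →L[ℂ] K) : H →L[ℂ] H :=
  (1 / 2 : ℂ) • ofBlocks K
    ((rootT K B + 1) * Ring.inverse (rootT K B))
    (Ring.inverse (rootT K B) ∘L B)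
    (B† ∘L Ring.inverse (rootT K B))
    (B† ∘L Ring.inverse (rootT K B * (rootT K B + 1)) ∘L B)

/-- The matched projection `m(E)` of an idempotent `E = [[1, B], [0, 0]]`, the matrix being taken
in the decomposition `H = R(E) ⊕ R(E)ᗮ`. -/
def matchedProj [CompleteSpace H] (E : H →L[ℂ] H) (hE : IsIdempotentElem E) : H →L[ℂ] H :=
  haveI := completeSpace_ran hE
  matchedBlocks (ran E) (upperRight (ran E) E)

/-! ### The retraction onto the symmetries -/

/-- `π(C) = C |C|⁻¹`, where `|C| = (C* C)^{1/2}`: for invertible `C`, in particular for `C² = 1`,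
the unitary part in the polar decomposition `C = π(C) |C|`. -/
def unitaryPart [CompleteSpace H] (C : H →L[ℂ] H) : H →L[ℂ] H :=
  C * Ring.inverse (CFC.abs C)

/-! ### Geodesics of the Grassmann manifold of orthogonal projections -/

/-- The `P`-codiagonal part of an operator `Y`. On selfadjoint operators it is the projection onto
the tangent space at `P` of the manifold of orthogonal projections. -/
def codiagPart (P Y : H →L[ℂ] H) : H →L[ℂ] H :=
  P * Y * (1 - P) + (1 - P) * Y * P

/-- `δ` is a geodesic of the manifold of orthogonal projections, for the linear connection which
differentiates a tangent field along a curve in the space of operators, and then projects onto the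
tangent space: the covariant derivative of the velocity `δ'` along `δ` vanishes. -/
structure IsGeodesic [CompleteSpace H] (δ : ℝ → H →L[ℂ] H) : Prop where
  smooth : ContDiff ℝ ∞ δ
  proj : ∀ t, IsStarProjection (δ t)
  geodesic_eq : ∀ t, codiagPart (δ t) (deriv (deriv δ) t) = 0

/-- `δ` is a geodesic with `δ 0 = P`, `δ 1 = Q` and speed less than `π / 2`. The bound on the speed
rules out the geodesics from `P` to `Q` that are not minimal. -/
structure IsGeodesicJoining [CompleteSpace H] (P Q : H →L[ℂ] H) (δ : ℝ → H →L[ℂ] H) : Prop where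
  isGeodesic : IsGeodesic δ
  source : δ 0 = P
  target : δ 1 = Q
  speed : ‖deriv δ 0‖ < Real.pi / 2

end

end MatchedProjection

/-! Everything is read off from the selfadjoint element d = E + E* - 1. Its square is 1 + (E* -
E)*(E* - E) ≥ 1 and commutes with E and E* (`gap_sq_eq`, `commute_gap_sq`), so |d| is invertible and
v = d|d|⁻¹ is a symmetry. Let C = 2E - 1, p = P_{R(E)}, q = P_{R(E*)}. Then vC = |C|
(`abs_reflection`), hence π(C) = v. Since pd = E and dp = E*, also vpv = q
(`symmetry_conj_rangeProj`).

Existence: the unitary w = v(2p - 1) has real part |d|⁻¹ > 0, so w = exp x with ‖x‖ < π/2, and x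
anticommutes with 2p - 1 (`direct_rotation_properties`, `exists_log_of_unitary`). The curve 2δ(t) -
1 = exp(2tx)(2p - 1) is a geodesic of speed ‖x‖; it passes through v at t = 1/2 and 2q - 1 at t = 1.

Uniqueness: the geodesic equation forces 2δ - 1 to have this exponential form, and the exponential
is injective on skew-adjoint elements of norm less than π.

Matched projection: T is the compression of |d| to R(E), and the four blocks of 2m(E) add up to v +
1 (`matched_blocks_sum`, `matchedProj_eq`). -/

namespace MatchedProjection

/-! ### Logarithms of unitaries and exponential curves of symmetries -/

section CStar

open NormedSpace selfAdjoint Unitary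

variable {A : Type*} [CStarAlgebra A]

/-- The exponential is injective on `i a`, for `a` selfadjoint of norm less than `π`. -/
theorem exp_I_smul_injOn {a b : A} (ha : IsSelfAdjoint a) (hb : IsSelfAdjoint b)
    (ha' : ‖a‖ < Real.pi) (hb' : ‖b‖ < Real.pi)
    (h : exp (Complex.I • a) = exp (Complex.I • b)) : a = b := by
  have h1 := argSelfAdjoint_expUnitary (x := ⟨a, ha⟩) ha'
  have h2 := argSelfAdjoint_expUnitary (x := ⟨b, hb⟩) hb'
  have h3 : expUnitary (⟨a, ha⟩ : selfAdjoint A) = expUnitary ⟨b, hb⟩ := Subtype.ext h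
  rw [h3, h2] at h1
  exact (congrArg Subtype.val h1).symm

/-- The exponential is injective on skew-adjoint elements of norm less than `π`. -/
theorem exp_injOn_of_star_eq_neg {x y : A} (hx : star x = -x) (hy : star y = -y)
    (hx' : ‖x‖ < Real.pi) (hy' : ‖y‖ < Real.pi) (h : exp x = exp y) : x = y := by
  have key : ∀ z : A, Complex.I • (-Complex.I) • z = z := fun z => by simp [smul_smul]
  have sa : ∀ z : A, star z = -z → IsSelfAdjoint ((-Complex.I) • z) := fun z hz => by
    simp [isSelfAdjoint_iff, hz]
  have := exp_I_smul_injOn (sa x hx) (sa y hy) (by simpa [norm_smul] using hx')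
    (by simpa [norm_smul] using hy') (by rw [key, key, h])
  rw [← key x, this, key]

theorem norm_mul_eq_of_symmetry {s : A} (hs : IsSelfAdjoint s) (h1 : s * s = 1) (x : A) :
    ‖x * s‖ = ‖x‖ := by
  have hu : s ∈ unitary A := by
    rw [Unitary.mem_iff, hs.star_eq]
    exact ⟨h1, h1⟩
  exact CStarRing.norm_mul_mem_unitary x hu

/-- A curve of symmetries `s` whose second derivative commutes with `s` is `t ↦ exp (t y) s₀`. -/
theorem symmetry_curve_eq_exp {s : ℝ → A} (hs : ContDiff ℝ 2 s) (h1 : ∀ t, s t * s t = 1)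
    (h2 : ∀ t, s t * deriv (deriv s) t = deriv (deriv s) t * s t) (t : ℝ) :
    s t = exp (t • (deriv s 0 * s 0)) * s 0 := by
  have d1 : ∀ t, HasDerivAt s (deriv s t) t := fun t =>
    (hs.differentiable (by norm_num) t).hasDerivAt
  have hs' : ContDiff ℝ 1 (deriv s) := by
    have : ContDiff ℝ (1 + 1) s := by
      have e : (1 + 1 : WithTop ℕ∞) = 2 := by norm_num
      rwa [e]
    exact (contDiff_succ_iff_deriv.mp this).2.2
  have d2 : ∀ t, HasDerivAt (deriv s) (deriv (deriv s) t) t := fun t =>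
    (hs'.differentiable (by norm_num) t).hasDerivAt
  have e1 : ∀ t, deriv s t * s t + s t * deriv s t = 0 := fun t => by
    have := ((d1 t).mul (d1 t)).unique (by
      have : s * s = fun _ => 1 := funext h1
      rw [this]; exact hasDerivAt_const t (1 : A))
    exact this
  -- Differentiating s² = 1 twice and using that s'' commutes with s gives (s's)' = 0, so s's is a
  -- constant y and s' = ys.
  have e2 : ∀ t, deriv (deriv s) t * s t + deriv s t * deriv s t = 0 := fun t => by
    have := (((d2 t).mul (d1 t)).add ((d1 t).mul (d2 t))).unique (by
      have : deriv s * s + s * deriv s = fun _ => 0 := funext e1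
      rw [this]; exact hasDerivAt_const t (0 : A))
    rw [h2 t] at this
    have h : (2 : ℝ) • (deriv (deriv s) t * s t + deriv s t * deriv s t) = 0 := by
      rw [← this, two_smul]; abel
    exact (smul_eq_zero.mp h).resolve_left two_ne_zero
  set y := deriv s 0 * s 0 with hy
  have hyc : ∀ t, deriv s t * s t = y := fun t =>
    is_const_of_deriv_eq_zero (f := fun t => deriv s t * s t)
      (fun t => ((d2 t).mul (d1 t)).differentiableAt)
      (fun t => by rw [← e2 t]; exact ((d2 t).mul (d1 t)).deriv) t 0
  have hd : ∀ t, deriv s t = y * s t := fun t => by rw [← hyc t, mul_assoc, h1, mul_one]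
  have de : ∀ t, HasDerivAt (fun u : ℝ => exp (u • (-y))) (exp (t • (-y)) * (-y)) t :=
    hasDerivAt_exp_smul_const (-y)
  have dp : ∀ t, HasDerivAt (fun u : ℝ => exp (u • (-y)) * s u) 0 t := fun t => by
    have := (de t).mul (d1 t)
    rw [hd t] at this
    have e : exp (t • (-y)) * (-y) * s t + exp (t • (-y)) * (y * s t) = 0 := by noncomm_ring
    rwa [e] at this
  have hc : exp (t • (-y)) * s t = s 0 := by
    have := is_const_of_deriv_eq_zero (fun t => (dp t).differentiableAt) (fun t => (dp t).deriv) t 0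
    simpa using this
  rw [← hc, ← mul_assoc]
  let _ : NormedAlgebra ℚ A := .restrictScalars ℚ ℝ A
  rw [← exp_add_of_commute (by simp), smul_neg, add_neg_cancel,
    exp_zero, one_mul]

theorem exp_smul_mul_symmetry {y s : A} (hys : y * s = -(s * y)) (t : ℝ) :
    exp (t • y) * s = s * exp (-(t • y)) := by
  let _ : NormedAlgebra ℚ A := .restrictScalars ℚ ℝ A
  have : SemiconjBy s (-(t • y)) (t • y) := by
    rw [SemiconjBy, smul_mul_assoc, hys, mul_neg, mul_smul_comm, smul_neg]
  exact this.exp_right.symm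

theorem exp_smul_mul_symmetry_mul_self {y s : A} (hys : y * s = -(s * y)) (hs : s * s = 1)
    (t : ℝ) : exp (t • y) * s * (exp (t • y) * s) = 1 := by
  let _ : NormedAlgebra ℚ A := .restrictScalars ℚ ℝ A
  nth_rw 1 [exp_smul_mul_symmetry hys]
  rw [mul_assoc, ← mul_assoc (exp _) (exp _), ← exp_add_of_commute (Commute.refl _).neg_left,
    neg_add_cancel, exp_zero, one_mul, hs]

theorem star_exp_smul_mul_symmetry {y s : A} (hys : y * s = -(s * y)) (hs : star s = s)
    (hy : star y = -y) (t : ℝ) : star (exp (t • y) * s) = exp (t • y) * s := by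
  let _ : NormedAlgebra ℚ A := .restrictScalars ℚ ℝ A
  rw [exp_smul_mul_symmetry hys, star_mul, star_exp, star_neg, star_smul, hy, hs]
  simp [exp_smul_mul_symmetry hys]

theorem hasDerivAt_exp_smul_mul (y s : A) (t : ℝ) :
    HasDerivAt (fun u : ℝ => exp (u • y) * s) (y * (exp (t • y) * s)) t := by
  rw [← mul_assoc]
  exact (hasDerivAt_exp_smul_const' y t).mul_const s

theorem contDiff_exp_smul_mul (y s : A) (n : WithTop ℕ∞) :
    ContDiff ℝ n (fun u : ℝ => exp (u • y) * s) := by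
  have : ContDiff ℝ n (exp : A → A) :=
    AnalyticOnNhd.contDiff (fun x _ => exp_analytic (𝕂 := ℝ) x)
  fun_prop

/-- A unitary `w` at distance less than `√2` from `1` has a logarithm of norm less than `π / 2`;
if a symmetry `s` conjugates `w` to its adjoint, then `s` anticommutes with the logarithm. -/
theorem exists_log_of_unitary {w : A} (hw : w ∈ unitary A) (hw1 : ‖w - 1‖ ^ 2 < 2) {s : A}
    (hs : IsSelfAdjoint s) (hss : s * s = 1) (hsw : s * w * s = star w) :
    ∃ x : A, star x = -x ∧ ‖x‖ < Real.pi / 2 ∧ exp x = w ∧ x * s = -(s * x) := by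
  have h2 : ‖((⟨w, hw⟩ : unitary A) - 1 : A)‖ < 2 := by
    change ‖w - 1‖ < 2
    nlinarith [norm_nonneg (w - 1)]
  set a := argSelfAdjoint ⟨w, hw⟩ with ha
  have hpi := norm_argSelfAdjoint_le_pi ⟨w, hw⟩
  have hcos := two_mul_one_sub_cos_norm_argSelfAdjoint h2
  have hexp : exp (Complex.I • (a : A)) = w := congrArg Subtype.val (expUnitary_argSelfAdjoint h2)
  -- 2(1 - cos ‖a‖) = ‖w - 1‖² < 2 forces cos ‖a‖ > 0.
  have hlt : ‖(a : A)‖ < Real.pi / 2 := by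
    by_contra hcon
    have := Real.cos_nonpos_of_pi_div_two_le_of_le (not_lt.mp hcon)
      (hpi.trans (by linarith [Real.pi_pos]))
    change 2 * (1 - Real.cos ‖(a : A)‖) = ‖w - 1‖ ^ 2 at hcos
    linarith
  have hst : star (Complex.I • (a : A)) = -(Complex.I • (a : A)) := by
    simp [a.2.star_eq]
  refine ⟨Complex.I • (a : A), hst, by simpa [norm_smul] using hlt, hexp, ?_⟩
  set x := Complex.I • (a : A) with hx
  have hxn : ‖x‖ < Real.pi / 2 := by simpa [hx, norm_smul] using hlt
  let _ : NormedAlgebra ℚ A := .restrictScalars ℚ ℝ A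
  -- Both sides are logarithms of w* of norm less than π.
  have hsx : s * x * s = -x := by
    refine exp_injOn_of_star_eq_neg ?_ ?_ ?_ ?_ ?_
    · simp [hst, hs.star_eq, mul_assoc]
    · simp [hst]
    · rw [norm_mul_eq_of_symmetry hs hss, ← norm_star, star_mul, hs.star_eq,
        norm_mul_eq_of_symmetry hs hss, norm_star]
      linarith [Real.pi_pos]
    · rw [norm_neg]; linarith [Real.pi_pos]
    · have := exp_units_conj (⟨s, s, hss, hss⟩ : Aˣ) x
      simp only [Units.inv_mk] at this
      rw [this, hexp, hsw, ← hst, ← star_exp, hexp]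
  calc x * s = s * s * x * s := by rw [hss, one_mul]
    _ = s * (s * x * s) := by noncomm_ring
    _ = _ := by rw [hsx, mul_neg]

end CStar

/-! ### Algebra of the gap d = e + e* - 1 -/

section Star

variable {A : Type*} [Ring A] [StarRing A] {e : A}

theorem gap_mul_left (he : IsIdempotentElem e) : (e + star e - 1) * e = star e * e := by
  rw [sub_mul, add_mul, he.eq]; noncomm_ring

theorem mul_gap_right (he : IsIdempotentElem e) : e * (e + star e - 1) = e * star e := by
  rw [mul_sub, mul_add, he.eq]; noncomm_ring

theorem isSelfAdjoint_gap (e : A) : IsSelfAdjoint (e + star e - 1) := by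
  simp [isSelfAdjoint_iff, add_comm]

theorem gap_sq_eq (he : IsIdempotentElem e) :
    (e + star e - 1) * (e + star e - 1) = 1 + (star (star e - e)) * (star e - e) := by
  have h1 := he.eq
  have h2 := he.star.eq
  simp only [star_sub, star_star, mul_sub, sub_mul, mul_add, add_mul, h1, h2, mul_one, one_mul]
  abel

/-- Both products reduce to e e* e. This is what makes every function of d² commute with e. -/
theorem commute_gap_sq (he : IsIdempotentElem e) :
    Commute ((e + star e - 1) * (e + star e - 1)) e := by
  have h1 : star e * (star e * e) = star e * e := by rw [← mul_assoc, he.star.eq]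
  have h2 : e * (star e * star e) = e * star e := by rw [he.star.eq]
  change _ * _ * _ = _
  rw [mul_assoc, gap_mul_left he, ← mul_assoc e, mul_gap_right he]
  simp only [sub_mul, add_mul, mul_sub, mul_add, mul_assoc, h1, h2, one_mul, mul_one]
  abel

theorem commute_gap_sq_star (he : IsIdempotentElem e) :
    Commute ((e + star e - 1) * (e + star e - 1)) (star e) := by
  simpa [add_comm] using commute_gap_sq he.star

end Star

/-! ### The symmetry d|d|⁻¹ and the absolute value of the reflection -/

section CStarOrder

variable {A : Type*} [CStarAlgebra A] [PartialOrder A] [StarOrderedRing A]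

/-- The absolute value `r ≥ 1` of a selfadjoint `d` with `d² ≥ 1`, together with its inverse. -/
theorem exists_abs_inverse {d : A} (hd : IsSelfAdjoint d) (h1 : 1 ≤ d * d) :
    ∃ r s : A, 0 ≤ r ∧ 0 ≤ s ∧ s ≤ 1 ∧ r * r = d * d ∧ r * s = 1 ∧ s * r = 1 ∧
      (∀ x, Commute (d * d) x → Commute r x) ∧ ∀ x, Commute (d * d) x → Commute s x := by
  have h0 : (0 : A) ≤ d * d := by simpa [hd.star_eq] using star_mul_self_nonneg d
  have hr0 : 0 ≤ CFC.sqrt (d * d) := CFC.sqrt_nonneg _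
  have hr1 : 1 ≤ CFC.sqrt (d * d) := by
    simpa using CFC.sqrt_le_sqrt 1 (d * d) h1
  have hrc : ∀ x, Commute (d * d) x → Commute (CFC.sqrt (d * d)) x :=
    fun x hx => Commute.cfcₙ_nnreal hx _
  have hrr : CFC.sqrt (d * d) * CFC.sqrt (d * d) = d * d := CFC.sqrt_mul_sqrt_self _ h0
  obtain ⟨u, hu⟩ := CStarAlgebra.isUnit_of_le 1 hr1
  generalize CFC.sqrt (d * d) = r at *
  have hrs : r * ↑u⁻¹ = 1 := by rw [← hu, Units.mul_inv]
  have hsr : ↑u⁻¹ * r = 1 := by rw [← hu, Units.inv_mul]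
  generalize (↑u⁻¹ : A) = s at *
  have hssa : star s = s := by
    have hrsa : star r = r := (IsSelfAdjoint.of_nonneg hr0).star_eq
    have : star s * r = 1 := by simpa [hrsa] using congrArg star hrs
    calc star s = star s * (r * s) := by rw [hrs, mul_one]
      _ = s := by rw [← mul_assoc, this, one_mul]
  have hs0 : 0 ≤ s := by
    have := star_left_conjugate_nonneg hr0 s
    rwa [hssa, hsr, one_mul] at this
  have hsc : ∀ x, Commute (d * d) x → Commute s x := fun x hx => by
    have h := (hrc x hx).eq
    change s * x = x * s
    calc s * x = s * (x * r) * s := by rw [mul_assoc, mul_assoc, hrs, mul_one]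
      _ = s * r * x * s := by rw [← h]; noncomm_ring
      _ = x * s := by rw [hsr, one_mul]
  refine ⟨r, s, hr0, hs0, ?_, hrr, hrs, hsr, hrc, hsc⟩
  have hcomm : Commute s (r - 1) := by
    change s * (r - 1) = (r - 1) * s
    rw [mul_sub, sub_mul, hrs, hsr, mul_one, one_mul]
  have := hcomm.mul_nonneg hs0 (sub_nonneg.mpr hr1)
  rwa [mul_sub, hsr, mul_one, sub_nonneg] at this

/-- A positive element has its norm in its spectrum, so ‖1 - s‖ = 1 would make s = 1 - (1 - s)
non-invertible. -/
theorem norm_one_sub_lt_one {r s : A} (hs0 : 0 ≤ s) (hs1 : s ≤ 1) (hrs : r * s = 1)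
    (hsr : s * r = 1) : ‖1 - s‖ < 1 := by
  nontriviality A
  have h0 : 0 ≤ 1 - s := sub_nonneg.mpr hs1
  have hle : ‖1 - s‖ ≤ 1 := by
    rw [CStarAlgebra.norm_le_one_iff_of_nonneg _ h0]
    exact sub_le_self _ hs0
  refine lt_of_le_of_ne hle fun h => ?_
  have hmem := CStarAlgebra.norm_mem_spectrum_of_nonneg (a := 1 - s) h0
  rw [h, spectrum.mem_iff] at hmem
  apply hmem
  simp only [map_one, sub_sub_cancel]
  exact ⟨⟨s, r, hsr, hrs⟩, rfl⟩

variable {e : A}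

theorem one_le_gap_sq (he : IsIdempotentElem e) :
    1 ≤ (e + star e - 1) * (e + star e - 1) := by
  rw [gap_sq_eq he]
  exact le_add_of_nonneg_right (star_mul_self_nonneg _)

/-- For `d = e + e* - 1` and `s = |d|⁻¹`, the operator `d s` is a symmetry. -/
theorem gap_mul_inverse_symmetry {r s : A} (he : IsIdempotentElem e)
    (hs0 : 0 ≤ s) (hrr : r * r = (e + star e - 1) * (e + star e - 1)) (hsr : s * r = 1)
    (hsc : ∀ x, Commute ((e + star e - 1) * (e + star e - 1)) x → Commute s x) :
    IsSelfAdjoint ((e + star e - 1) * s) ∧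
      (e + star e - 1) * s * ((e + star e - 1) * s) = 1 := by
  have hse := hsc e (commute_gap_sq he)
  have hse' := hsc _ (commute_gap_sq_star he)
  have hsd : Commute s (e + star e - 1) := (hse.add_right hse').sub_right (Commute.one_right s)
  constructor
  · rw [isSelfAdjoint_iff, star_mul, (isSelfAdjoint_gap e).star_eq,
      (IsSelfAdjoint.of_nonneg hs0).star_eq, hsd.eq]
  · rw [← hsd.eq, mul_assoc, ← mul_assoc _ s, ← hsd.eq, mul_assoc, ← hrr]
    calc s * (s * (r * r)) = s * ((s * r) * r) := by rw [mul_assoc]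
      _ = 1 := by rw [hsr, one_mul, hsr]

/-- If `d = e + e* - 1`, `r = |d|` and `s = r⁻¹`, then `(d s) (2 e - 1)` is the absolute value of
the reflection `2 e - 1`. -/
theorem abs_reflection {r s : A} (he : IsIdempotentElem e)
    (hs0 : 0 ≤ s) (hrr : r * r = (e + star e - 1) * (e + star e - 1))
    (hsr : s * r = 1)
    (hsc : ∀ x, Commute ((e + star e - 1) * (e + star e - 1)) x → Commute s x) :
    CFC.abs (2 * e - 1) = (e + star e - 1) * s * (2 * e - 1) := by
  have hse := hsc e (commute_gap_sq he)
  have hse' := hsc _ (commute_gap_sq_star he)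
  have hsd : Commute s (e + star e - 1) := (hse.add_right hse').sub_right (Commute.one_right s)
  -- This writes d(2e - 1) as a sum of two squares, hence as a positive element; its product with
  -- the commuting s ≥ 0 stays positive.
  have hdc : (e + star e - 1) * (2 * e - 1)
      = star e * e + star (1 - e) * (1 - e) := by
    have h1 := he.eq
    have : (e + star e - 1) * (2 * e - 1)
      = 2 * (e * e) + 2 * (star e * e) - 2 * e - e - star e + 1 := by noncomm_ring
    rw [this, h1, star_sub, star_one]
    noncomm_ring
  have hnn : 0 ≤ (e + star e - 1) * (2 * e - 1) := by
    rw [hdc]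
    exact add_nonneg (star_mul_self_nonneg _) (star_mul_self_nonneg _)
  have hs2 : Commute s (2 * e - 1) := by
    have : (2 : A) * e = e + e := two_mul e
    rw [this]
    exact (hse.add_right hse).sub_right (Commute.one_right s)
  have hpos : 0 ≤ (e + star e - 1) * s * (2 * e - 1) := by
    rw [← hsd.eq, mul_assoc]
    exact (hsd.mul_right hs2).mul_nonneg hs0 hnn
  refine CFC.sqrt_unique ?_ hpos
  have hst : star ((e + star e - 1) * s * (2 * e - 1)) = (e + star e - 1) * s * (2 * e - 1) :=
    (IsSelfAdjoint.of_nonneg hpos).star_eq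
  obtain ⟨hvst, hvv⟩ := gap_mul_inverse_symmetry he hs0 hrr hsr hsc
  generalize (e + star e - 1) * s = v at *
  calc v * (2 * e - 1) * (v * (2 * e - 1))
      = star (v * (2 * e - 1)) * (v * (2 * e - 1)) := by rw [hst]
    _ = star (2 * e - 1) * (v * v) * (2 * e - 1) := by
      rw [star_mul, hvst.star_eq]; noncomm_ring
    _ = _ := by rw [hvv, mul_one]

end CStarOrder

/-! ### Range projections of e and e* -/

section RangeProjection

variable {A : Type*} [Ring A] [StarRing A] {e p q r s : A}

theorem rangeProj_mul_gap (hp : IsSelfAdjoint p) (hpe : p * e = e) (hep : e * p = p) :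
    p * (e + star e - 1) = e := by
  have : p * star e = p := by simpa [hp.star_eq] using congrArg star hep
  rw [mul_sub, mul_add, hpe, this, mul_one, add_sub_cancel_right]

theorem gap_mul_rangeProj (hp : IsSelfAdjoint p) (hpe : p * e = e) (hep : e * p = p) :
    (e + star e - 1) * p = star e := by
  have := congrArg star (rangeProj_mul_gap hp hpe hep)
  rwa [star_mul, hp.star_eq, (isSelfAdjoint_gap e).star_eq] at this

/-- Both products equal e e*. -/
theorem commute_gap_sq_rangeProj (he : IsIdempotentElem e) (hp : IsSelfAdjoint p)
    (hpe : p * e = e) (hep : e * p = p) :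
    Commute ((e + star e - 1) * (e + star e - 1)) p := by
  change _ * _ * _ = _
  rw [mul_assoc, gap_mul_rangeProj hp hpe hep, ← mul_assoc p, rangeProj_mul_gap hp hpe hep,
    mul_gap_right he]
  have := gap_mul_left he.star
  rwa [star_star, add_comm (star e)] at this

/-- The difference `d = e + e* - 1` intertwines the range projections of `e` and `e*`. -/
theorem gap_mul_rangeProj_mul_gap (hp : IsSelfAdjoint p) (hpe : p * e = e) (hep : e * p = p)
    (hq : IsSelfAdjoint q) (hqe : q * star e = star e) (heq : star e * q = q) :
    (e + star e - 1) * p * (e + star e - 1) = q * ((e + star e - 1) * (e + star e - 1)) := by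
  have h := rangeProj_mul_gap hq hqe heq
  rw [star_star, add_comm (star e)] at h
  rw [gap_mul_rangeProj hp hpe hep, ← mul_assoc, h]

theorem symmetry_of_projection {A : Type*} [Ring A] {a : A} (ha : IsIdempotentElem a) :
    (2 * a - 1) * (2 * a - 1) = 1 := by
  have : (2 * a - 1) * (2 * a - 1) = 4 * (a * a) - 4 * a + 1 := by noncomm_ring
  rw [this, ha.eq]; noncomm_ring

theorem isSelfAdjoint_two_mul_sub_one {a : A}
    (ha : IsSelfAdjoint a) : IsSelfAdjoint (2 * a - 1) := by
  rw [two_mul]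
  exact (ha.add ha).sub (.one A)

/-- The symmetry `d s`, for `d = e + e* - 1` and `s = |d|⁻¹`, exchanges the range projections `p`
and `q` of `e` and `e*`. -/
theorem symmetry_conj_rangeProj (he : IsIdempotentElem e)
    (hrr : r * r = (e + star e - 1) * (e + star e - 1)) (hrs : r * s = 1)
    (hsc : ∀ x, Commute ((e + star e - 1) * (e + star e - 1)) x → Commute s x)
    (hp : IsSelfAdjoint p) (hpe : p * e = e) (hep : e * p = p)
    (hq : IsSelfAdjoint q) (hqe : q * star e = star e) (heq : star e * q = q) :
    (e + star e - 1) * s * p * ((e + star e - 1) * s) = q := by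
  have hse := hsc e (commute_gap_sq he)
  have hse' := hsc _ (commute_gap_sq_star he)
  have hsp := hsc p (commute_gap_sq_rangeProj he hp hpe hep)
  have hsd : Commute s (e + star e - 1) := (hse.add_right hse').sub_right (Commute.one_right s)
  have hd := gap_mul_rangeProj_mul_gap hp hpe hep hq hqe heq
  rw [← hrr] at hd
  generalize e + star e - 1 = d at *
  calc d * s * p * (d * s) = d * (s * p) * d * s := by noncomm_ring
    _ = d * p * (s * d) * s := by rw [hsp.eq]; noncomm_ring
    _ = d * p * d * (s * s) := by rw [hsd.eq]; noncomm_ring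
    _ = q * (r * (r * s) * s) := by rw [hd]; noncomm_ring
    _ = q := by rw [hrs, mul_one, hrs, mul_one]

end RangeProjection

/-! ### The direct rotation from R(e) to R(e*) -/

section CStarOrder

variable {A : Type*} [CStarAlgebra A] [PartialOrder A] [StarOrderedRing A] {e p r s : A}

/-- The unitary `w = d s (2 p - 1)`, which maps the range of `e` onto the one of `e*`, has positive
invertible real part `s`; hence it is close to `1`. -/
theorem direct_rotation_properties (he : IsIdempotentElem e) (hs0 : 0 ≤ s) (hs1 : s ≤ 1)
    (hrr : r * r = (e + star e - 1) * (e + star e - 1)) (hrs : r * s = 1) (hsr : s * r = 1)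
    (hsc : ∀ x, Commute ((e + star e - 1) * (e + star e - 1)) x → Commute s x)
    (hp : IsStarProjection p) (hpe : p * e = e) (hep : e * p = p) :
    (e + star e - 1) * s * (2 * p - 1) ∈ unitary A ∧
      ‖(e + star e - 1) * s * (2 * p - 1) - 1‖ ^ 2 < 2 ∧
      (2 * p - 1) * ((e + star e - 1) * s * (2 * p - 1)) * (2 * p - 1)
        = star ((e + star e - 1) * s * (2 * p - 1)) := by
  have hse := hsc e (commute_gap_sq he)
  have hse' := hsc _ (commute_gap_sq_star he)
  have hsp := hsc p (commute_gap_sq_rangeProj he hp.2 hpe hep)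
  have hsd : Commute s (e + star e - 1) := (hse.add_right hse').sub_right (Commute.one_right s)
  obtain ⟨hvst, hvv⟩ := gap_mul_inverse_symmetry he hs0 hrr hsr hsc
  have h2 := symmetry_of_projection hp.1
  have h3 := isSelfAdjoint_two_mul_sub_one hp.2
  -- w + w* = 2s, because dp = e*, pd = e and e + e* - d = 1.
  have hanti : (e + star e - 1) * s * (2 * p - 1) + (2 * p - 1) * ((e + star e - 1) * s)
      = 2 * s := by
    have e1 : (e + star e - 1) * s * (2 * p - 1) + (2 * p - 1) * ((e + star e - 1) * s)
      = 2 * ((e + star e - 1) * (s * p)) + 2 * ((p * (e + star e - 1)) * s)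
        - 2 * ((e + star e - 1) * s) := by noncomm_ring
    rw [e1, hsp.eq, ← mul_assoc _ p, gap_mul_rangeProj hp.2 hpe hep,
      rangeProj_mul_gap hp.2 hpe hep]
    noncomm_ring
  generalize (e + star e - 1) * s = v at *
  generalize 2 * p - 1 = t at *
  have hstar : star (v * t) = t * v := by rw [star_mul, hvst.star_eq, h3.star_eq]
  have hm1 : t * v * (v * t) = 1 := by
    rw [mul_assoc, ← mul_assoc v, hvv, one_mul, h2]
  have hm2 : v * t * (t * v) = 1 := by
    rw [mul_assoc, ← mul_assoc t, h2, one_mul, hvv]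
  refine ⟨?_, ?_, ?_⟩
  · rw [Unitary.mem_iff, hstar]
    exact ⟨hm1, hm2⟩
  · rw [sq, ← CStarRing.norm_star_mul_self, star_sub, hstar, star_one]
    -- (w - 1)*(w - 1) = 2 - (w + w*), whose norm 2‖1 - s‖ is less than 2.
    have : (t * v - 1) * (v * t - 1) = (2 : ℝ) • (1 - s) := by
      have : (t * v - 1) * (v * t - 1) = t * v * (v * t) + 1 - (v * t + t * v) := by noncomm_ring
      rw [this, hm1, hanti, two_smul]
      noncomm_ring
    rw [this, norm_smul]
    have := norm_one_sub_lt_one hs0 hs1 hrs hsr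
    simp only [Real.norm_ofNat]
    linarith
  · rw [hstar, mul_assoc, mul_assoc, h2, mul_one]

end CStarOrder

/-! ### Summing the blocks of the matched projection -/

theorem ring_inverse_eq_of_mul_eq_one {M : Type*} [Ring M] {a b : M} (hab : a * b = 1)
    (hba : b * a = 1) : Ring.inverse a = b :=
  Ring.inverse_unit (⟨a, b, hab, hba⟩ : Mˣ)

theorem commute_of_inverse {M : Type*} [Ring M] {a b x : M} (hab : a * b = 1)
    (hba : b * a = 1) (h : Commute a x) : Commute b x :=
  calc b * x = b * (x * a) * b := by rw [mul_assoc, mul_assoc, hab, mul_one]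
    _ = b * a * x * b := by rw [← h.eq]; noncomm_ring
    _ = x * b := by rw [hba, one_mul]

/-- The blocks of `2 m(e)`, summed up in terms of `d = e + e* - 1`, `r = |d|`, `s = r⁻¹` and
`u = (r + 1)⁻¹`. -/
theorem matched_blocks_sum {A : Type*} [Ring A] [StarRing A] {e p r s u : A}
    (he : IsIdempotentElem e) (hp : IsStarProjection p) (hpe : p * e = e) (hep : e * p = p)
    (hrr : r * r = (e + star e - 1) * (e + star e - 1)) (hrs : r * s = 1) (hsr : s * r = 1)
    (hu1 : (r + 1) * u = 1) (hu2 : u * (r + 1) = 1)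
    (hrc : ∀ x, Commute ((e + star e - 1) * (e + star e - 1)) x → Commute r x) :
    p * ((r + 1) * s) * p + p * (s * p * e) * (1 - p) + (1 - p) * (star e * p * s) * p
      + (1 - p) * (star e * p * (s * u) * p * e) * (1 - p) = (e + star e - 1) * s + 1 := by
  have hre := hrc e (commute_gap_sq he)
  have hre' := hrc _ (commute_gap_sq_star he)
  have hrp := hrc p (commute_gap_sq_rangeProj he hp.2 hpe hep)
  have hse := commute_of_inverse hrs hsr hre
  have hse' := commute_of_inverse hrs hsr hre'
  have hsp := commute_of_inverse hrs hsr hrp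
  have hue := commute_of_inverse hu1 hu2 (hre.add_left (Commute.one_left _))
  have hpp := hp.1.eq
  have hpe' : p * star e = p := by simpa [hp.2.star_eq] using congrArg star hep
  have hep' : star e * p = star e := by simpa [hp.2.star_eq] using congrArg star hpe
  have hup := commute_of_inverse hu1 hu2 (hrp.add_left (Commute.one_left _))
  have t1 : p * ((r + 1) * s) * p = p + s * p := by
    rw [add_mul, hrs, one_mul, mul_add, mul_one, add_mul, hpp, ← hsp.eq, mul_assoc, hpp]
  have t2 : p * (s * p * e) * (1 - p) = s * (e - p) := by
    calc p * (s * p * e) * (1 - p) = p * s * (p * e) * (1 - p) := by noncomm_ring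
      _ = s * (p * e) * (1 - p) := by rw [← hsp.eq, hpe, mul_assoc s, hpe]
      _ = s * (e - e * p) := by rw [hpe]; noncomm_ring
      _ = _ := by rw [hep]
  have t3 : (1 - p) * (star e * p * s) * p = s * (star e - p) := by
    calc (1 - p) * (star e * p * s) * p = (star e - p * star e) * s * p := by
          rw [hep']; noncomm_ring
      _ = star e * s * p - p * s * p := by rw [hpe']; noncomm_ring
      _ = s * (star e * p - p * p) := by rw [← hse'.eq, ← hsp.eq]; noncomm_ring
      _ = _ := by rw [hep', hpp]
  -- (e* - p)(e - p) = (1 - p)(r² - 1), and the factor r + 1 of r² - 1 cancels u.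
  have t4 : (1 - p) * (star e * p * (s * u) * p * e) * (1 - p) = 1 - s - p + s * p := by
    calc (1 - p) * (star e * p * (s * u) * p * e) * (1 - p)
        = (star e * p - p * star e * p) * (s * u) * (p * e - p * (e * p)) := by noncomm_ring
      _ = (star e - p) * (s * u) * (e - p) := by rw [hpe', hep', hep, hpe, hpp]
      _ = (star e - p) * (e - p) * (s * u) := by
          rw [mul_assoc, mul_assoc (star e - p) (e - p)]
          congr 1
          exact ((hse.mul_left hue).sub_right (hsp.mul_left hup)).eq
      _ = (1 - p) * (r * r - 1) * (s * u) := by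
          congr 1
          have h1 : (star e - p) * (e - p) = star e * e - star e * p - p * e + p * p := by
            noncomm_ring
          have h2 : p * (r * r) = e * star e := by
            rw [hrr, ← mul_assoc, rangeProj_mul_gap hp.2 hpe hep, mul_gap_right he]
          have h3 : (1 - p) * (r * r - 1) = r * r - p * (r * r) - 1 + p := by noncomm_ring
          rw [h1, h3, h2, hrr, hep', hpe, hpp]
          simp only [sub_mul, add_mul, mul_sub, mul_add, he.eq, he.star.eq, mul_one, one_mul]
          abel
      _ = (1 - p) * (r - 1) * ((r + 1) * s * u) := by noncomm_ring
      _ = (1 - p) * (r - 1) * s := by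
          have : (r + 1) * s = s * (r + 1) := by rw [add_mul, mul_add, hrs, hsr, one_mul, mul_one]
          rw [this, mul_assoc s, hu1, mul_one]
      _ = r * s - s - p * (r * s) + p * s := by noncomm_ring
      _ = _ := by rw [hrs, hsp.eq, mul_one]
  rw [t1, t2, t3, t4]
  have : (e + star e - 1) * s = s * (e + star e - 1) :=
    (((hse.add_right hse').sub_right (Commute.one_right s)).eq).symm
  rw [this]
  noncomm_ring

/-! ### Compressions to subspaces -/

section Blocks

variable {H : Type*} [NormedAddCommGroup H] [InnerProductSpace ℂ H]

/-- The compression of an operator to a pair of subspaces. -/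
noncomputable abbrev compression (K L : Submodule ℂ H) [L.HasOrthogonalProjection] (X : H →L[ℂ] H) :
    K →L[ℂ] L :=
  L.orthogonalProjectionOnto ∘L X ∘L K.subtypeL

theorem compression_comp (K L M : Submodule ℂ H) [L.HasOrthogonalProjection]
    [M.HasOrthogonalProjection] (X Y : H →L[ℂ] H) :
    compression L M X ∘L compression K L Y = compression K M (X * L.starProjection * Y) := rfl

theorem compression_add (K L : Submodule ℂ H) [L.HasOrthogonalProjection] (X Y : H →L[ℂ] H) :
    compression K L (X + Y) = compression K L X + compression K L Y := by
  ext x; simp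

theorem compression_one (K : Submodule ℂ H) [K.HasOrthogonalProjection] :
    compression K K 1 = 1 := by
  ext x; simp

theorem compression_starProjection_mul (K : Submodule ℂ H) [K.HasOrthogonalProjection]
    (X : H →L[ℂ] H) : compression K K (K.starProjection * X) = compression K K X := by
  ext x
  exact congrArg Subtype.val
    (K.orthogonalProjectionOnto_mem_subspace_eq_self (K.orthogonalProjectionOnto (X x)))

/-- Compression is multiplicative on operators reduced by K; inverses and square roots of such
operators can thus be computed on H. -/
theorem compression_mul_of_commute (K : Submodule ℂ H) [K.HasOrthogonalProjection]
    {X Y : H →L[ℂ] H} (h : Commute Y K.starProjection) :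
    compression K K X * compression K K Y = compression K K (X * Y) := by
  change compression K K X ∘L compression K K Y = _
  rw [compression_comp, mul_assoc, ← h.eq]
  ext x; simp

theorem adjoint_compression [CompleteSpace H] (K L : Submodule ℂ H) [CompleteSpace K]
    [CompleteSpace L] (X : H →L[ℂ] H) :
    (compression K L X)† = compression L K (star X) := by
  rw [compression, ContinuousLinearMap.adjoint_comp, ContinuousLinearMap.adjoint_comp,
    Submodule.adjoint_orthogonalProjectionOnto, Submodule.adjoint_subtypeL]
  rfl

theorem compression_nonneg [CompleteSpace H] (K : Submodule ℂ H) [CompleteSpace K]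
    {X : H →L[ℂ] H} (h : 0 ≤ X) : 0 ≤ compression K K X := by
  rw [ContinuousLinearMap.nonneg_iff_isPositive] at h ⊢
  have := h.adjoint_conj K.subtypeL
  rwa [Submodule.adjoint_subtypeL] at this

theorem ofBlocks_compression (K : Submodule ℂ H) [K.HasOrthogonalProjection]
    (X Y Z W : H →L[ℂ] H) :
    ofBlocks K (compression K K X) (compression Kᗮ K Y) (compression K Kᗮ Z)
        (compression Kᗮ Kᗮ W)
      = K.starProjection * X * K.starProjection + K.starProjection * Y * (1 - K.starProjection)
        + (1 - K.starProjection) * Z * K.starProjection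
        + (1 - K.starProjection) * W * (1 - K.starProjection) := by
  have h : (1 - K.starProjection) = Kᗮ.starProjection := by
    rw [K.starProjection_orthogonal']
  rw [h, ofBlocks, ContinuousLinearMap.comp_add, ContinuousLinearMap.comp_add, ← add_assoc]
  rfl

end Blocks

theorem posSqrt_unique {V : Type*} [NormedAddCommGroup V] [InnerProductSpace ℂ V]
    [CompleteSpace V] {a b : V →L[ℂ] V} (h : b * b = a) (hb : 0 ≤ b) : posSqrt a = b :=
  CFC.sqrt_unique h hb

/-- Twice the codiagonal part is Y - SYS, with S = 2P - 1. The geodesic equation becomes a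
commutation relation for the curve of symmetries. -/
theorem codiagPart_eq_zero_iff {H : Type*} [NormedAddCommGroup H] [InnerProductSpace ℂ H]
    {P Y : H →L[ℂ] H} (hP : IsIdempotentElem P) :
    codiagPart P Y = 0 ↔ Commute (2 * P - 1) Y := by
  have h2 := symmetry_of_projection hP
  have key : (2 : ℂ) • codiagPart P Y = Y - (2 * P - 1) * Y * (2 * P - 1) := by
    rw [codiagPart, two_smul]; noncomm_ring
  constructor
  · intro h
    rw [h, smul_zero] at key
    have := sub_eq_zero.mp key.symm
    change _ * _ = _ * _
    calc (2 * P - 1) * Y = (2 * P - 1) * Y * ((2 * P - 1) * (2 * P - 1)) := by rw [h2, mul_one]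
      _ = (2 * P - 1) * Y * (2 * P - 1) * (2 * P - 1) := by simp only [mul_assoc]
      _ = _ := by rw [← this]
  · intro h
    rw [h.eq, mul_assoc, h2, mul_one, sub_self] at key
    exact (smul_eq_zero.mp key).resolve_left two_ne_zero

/-! ### The matched projection and geodesics on the Hilbert space -/

section Operators

variable {H : Type*} [NormedAddCommGroup H] [InnerProductSpace ℂ H] [CompleteSpace H]

theorem isStarProjection_rangeProj (E : H →L[ℂ] H) (hE : IsIdempotentElem E) :
    IsStarProjection (rangeProj E hE) := by
  have := completeSpace_ran hE
  exact isStarProjection_starProjection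

theorem rangeProj_mul (E : H →L[ℂ] H) (hE : IsIdempotentElem E) : rangeProj E hE * E = E := by
  have := completeSpace_ran hE
  ext x
  exact Submodule.starProjection_eq_self_iff.mpr (LinearMap.mem_range_self _ x)

theorem mul_rangeProj (E : H →L[ℂ] H) (hE : IsIdempotentElem E) :
    E * rangeProj E hE = rangeProj E hE := by
  have := completeSpace_ran hE
  ext x
  obtain ⟨y, hy⟩ := (ran E).starProjection_apply_mem x
  change E ((ran E).starProjection x) = (ran E).starProjection x
  rw [← hy]
  exact congrArg (fun F : H →L[ℂ] H => F y) hE.eq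

theorem matchedProj_eq {E r s : H →L[ℂ] H} (hE : IsIdempotentElem E) (hr0 : 0 ≤ r)
    (hrr : r * r = (E + star E - 1) * (E + star E - 1)) (hrs : r * s = 1) (hsr : s * r = 1)
    (hrc : ∀ x, Commute ((E + star E - 1) * (E + star E - 1)) x → Commute r x) :
    matchedProj E hE = (1 / 2 : ℂ) • ((E + star E - 1) * s + 1) := by
  have := completeSpace_ran hE
  have hp : IsStarProjection (ran E).starProjection := isStarProjection_rangeProj E hE
  have hpe : (ran E).starProjection * E = E := rangeProj_mul E hE
  have hep : E * (ran E).starProjection = (ran E).starProjection := mul_rangeProj E hE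
  have hpe' : (ran E).starProjection * star E = (ran E).starProjection := by
    simpa [hp.2.star_eq] using congrArg star hep
  obtain ⟨v, hv⟩ : IsUnit (r + 1) :=
    CStarAlgebra.isUnit_of_le 1 (le_add_of_nonneg_left hr0)
  have hu1 : (r + 1) * ↑v⁻¹ = 1 := by rw [← hv, Units.mul_inv]
  have hu2 : ↑v⁻¹ * (r + 1) = 1 := by rw [← hv, Units.inv_mul]
  generalize (↑v⁻¹ : H →L[ℂ] H) = u at *
  have hcp := commute_gap_sq_rangeProj hE hp.2 hpe hep
  have hrp := hrc _ hcp
  have hsp := commute_of_inverse hrs hsr hrp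
  have hup := commute_of_inverse hu1 hu2 (hrp.add_left (Commute.one_left _))
  set K := ran E with hK
  have hB : upperRight K E = compression Kᗮ K E := rfl
  have hBs : (compression Kᗮ K E)† = compression K Kᗮ (star E) := adjoint_compression _ _ _
  -- With p the projection onto K, p(1 + E(1 - p)E*) and p d² both equal E E*, so the compression of
  -- r = |d| is a positive root of 1 + BB*.
  have hT : rootT K (compression Kᗮ K E) = compression K K r := by
    refine posSqrt_unique ?_ (compression_nonneg K hr0)
    rw [compression_mul_of_commute K hrp, hBs, compression_comp, ← compression_one K,
      ← compression_add, Submodule.starProjection_orthogonal']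
    rw [← compression_starProjection_mul K (r * r),
      ← compression_starProjection_mul K (1 + E * (1 - K.starProjection) * star E)]
    congr 1
    rw [hrr, ← mul_assoc, rangeProj_mul_gap hp.2 hpe hep, mul_gap_right hE]
    have : K.starProjection * (1 + E * (1 - K.starProjection) * star E)
      = K.starProjection + K.starProjection * E * star E
        - K.starProjection * (E * K.starProjection) * star E := by noncomm_ring
    rw [this, hpe, hep, hp.1.eq, hpe']
    abel
  have hTi : Ring.inverse (compression K K r) = compression K K s := by
    apply ring_inverse_eq_of_mul_eq_one
    · rw [compression_mul_of_commute K hsp, hrs, compression_one]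
    · rw [compression_mul_of_commute K hrp, hsr, compression_one]
  have hT1 : compression K K r + 1 = compression K K (r + 1) := by
    rw [compression_add, compression_one]
  have hr1p : Commute (r + 1) K.starProjection := hrp.add_left (Commute.one_left _)
  have hTT : Ring.inverse (compression K K r * compression K K (r + 1))
      = compression K K (s * u) := by
    have hrr1 : r * (r + 1) = (r + 1) * r := by noncomm_ring
    apply ring_inverse_eq_of_mul_eq_one
    · rw [compression_mul_of_commute K hr1p, compression_mul_of_commute K (hsp.mul_left hup), hrr1,
        ← compression_one K]
      congr 1
      calc (r + 1) * r * (s * u) = (r + 1) * (r * s) * u := by noncomm_ring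
        _ = 1 := by rw [hrs, mul_one, hu1]
    · rw [compression_mul_of_commute K hr1p, compression_mul_of_commute K (hrp.mul_left hr1p), hrr1,
        ← compression_one K]
      congr 1
      calc s * u * ((r + 1) * r) = s * (u * (r + 1)) * r := by noncomm_ring
        _ = 1 := by rw [hu2, mul_one, hsr]
  change matchedBlocks K (upperRight K E) = _
  rw [matchedBlocks, hB, hT, hTi, hT1, hTT, hBs, compression_mul_of_commute K hsp,
    compression_comp, compression_comp, compression_comp, compression_comp, ofBlocks_compression]
  congr 1
  rw [← matched_blocks_sum hE hp hpe hep hrr hrs hsr hu1 hu2 hrc]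
  rfl

theorem hasDerivAt_deriv_of_isGeodesic {δ : ℝ → H →L[ℂ] H} (h : IsGeodesic δ) (t : ℝ) :
    HasDerivAt δ (deriv δ t) t :=
  (h.smooth.differentiable (by simp) t).hasDerivAt

/-- The symmetry curve `2 δ - 1` of a geodesic `δ` is `t ↦ exp (t y) (2 δ(0) - 1)`. -/
theorem IsGeodesic.symmetry_eq {δ : ℝ → H →L[ℂ] H} (h : IsGeodesic δ) :
    ∃ y : H →L[ℂ] H, star y = -y ∧ ‖y‖ = 2 * ‖deriv δ 0‖ ∧
      ∀ t : ℝ, 2 * δ t - 1 = NormedSpace.exp (t • y) * (2 * δ 0 - 1) := by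
  set s : ℝ → H →L[ℂ] H := fun t => 2 * δ t - 1 with hs
  have d1 : ∀ t, HasDerivAt s (2 * deriv δ t) t := fun t =>
    ((hasDerivAt_deriv_of_isGeodesic h t).const_mul 2).sub_const 1
  have e1 : deriv s = fun t => 2 * deriv δ t := funext fun t => (d1 t).deriv
  have hsm : ContDiff ℝ 2 s :=
    (contDiff_const.mul (contDiff_infty.mp h.smooth 2)).sub contDiff_const
  have hsq : ∀ t, s t * s t = 1 := fun t => symmetry_of_projection (h.proj t).1
  have hsa : ∀ t, star (s t) = s t := fun t => isSelfAdjoint_two_mul_sub_one (h.proj t).2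
  have hδ' : ContDiff ℝ 1 (deriv δ) := by
    have : ContDiff ℝ (1 + 1) δ := by exact_mod_cast contDiff_infty.mp h.smooth 2
    exact (contDiff_succ_iff_deriv.mp this).2.2
  have e2 : ∀ t, deriv (deriv s) t = 2 * deriv (deriv δ) t := fun t => by
    rw [e1]
    exact ((hδ'.differentiable (by norm_num) t).hasDerivAt.const_mul 2).deriv
  have hcom : ∀ t, s t * deriv (deriv s) t = deriv (deriv s) t * s t := fun t => by
    have := (codiagPart_eq_zero_iff (h.proj t).1).mp (h.geodesic_eq t)
    rw [e2, two_mul]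
    exact (this.add_right this).eq
  have hds : star (deriv s 0) = deriv s 0 := by
    have a1 : HasDerivAt s (deriv s 0) 0 := by rw [e1]; exact d1 0
    have a2 := a1.star
    have : (fun t => star (s t)) = s := funext hsa
    rw [this] at a2
    exact a2.unique a1
  have hanti : deriv s 0 * s 0 + s 0 * deriv s 0 = 0 := by
    have a1 : HasDerivAt s (deriv s 0) 0 := by rw [e1]; exact d1 0
    refine (a1.mul a1).unique ?_
    have : s * s = fun _ => 1 := funext hsq
    rw [this]; exact hasDerivAt_const (0 : ℝ) (1 : H →L[ℂ] H)
  refine ⟨deriv s 0 * s 0, ?_, ?_, fun t => symmetry_curve_eq_exp hsm hsq hcom t⟩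
  · rw [star_mul, hds, hsa]
    exact eq_neg_of_add_eq_zero_right hanti
  · rw [norm_mul_eq_of_symmetry (hsa 0) (hsq 0), e1]
    have : (2 : H →L[ℂ] H) * deriv δ 0 = (2 : ℝ) • deriv δ 0 := by rw [two_mul, two_smul]
    simp only
    rw [this, norm_smul, Real.norm_ofNat]

/-- There is at most one geodesic of speed less than `π / 2` between two projections. -/
theorem IsGeodesicJoining.unique {P Q : H →L[ℂ] H} {δ η : ℝ → H →L[ℂ] H}
    (hδ : IsGeodesicJoining P Q δ) (hη : IsGeodesicJoining P Q η) : η = δ := by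
  obtain ⟨y, hy1, hy2, hy3⟩ := hδ.isGeodesic.symmetry_eq
  obtain ⟨z, hz1, hz2, hz3⟩ := hη.isGeodesic.symmetry_eq
  have hsp := hδ.speed
  have hsp' := hη.speed
  have hP : IsIdempotentElem P := hδ.source ▸ (hδ.isGeodesic.proj 0).1
  rw [hδ.source] at hy3
  rw [hη.source] at hz3
  have e : NormedSpace.exp y = NormedSpace.exp z := by
    have a := hy3 1
    have b := hz3 1
    rw [hδ.target, one_smul] at a
    rw [hη.target, one_smul, a] at b
    have := congrArg (· * (2 * P - 1)) b
    simpa only [mul_assoc, symmetry_of_projection hP, mul_one] using this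
  -- Passing from δ to 2δ - 1 doubles the speed, so the bound π/2 becomes the bound π that
  -- injectivity needs.
  have hyz : y = z :=
    exp_injOn_of_star_eq_neg hy1 hz1 (by linarith) (by linarith) e
  funext t
  have h : 2 * η t - 1 = 2 * δ t - 1 := by rw [hy3, hz3, hyz]
  have h2 : (2 : ℂ) • η t = (2 : ℂ) • δ t := by
    rw [two_smul, two_smul, ← two_mul, ← two_mul]
    exact sub_left_injective h
  exact smul_right_injective _ two_ne_zero h2

/-- A skew-adjoint `x` which anticommutes with the symmetry `2 P - 1` generates a geodesic. -/
theorem exists_isGeodesic {P x : H →L[ℂ] H} (hP : IsStarProjection P) (hx : star x = -x)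
    (hanti : x * (2 * P - 1) = -((2 * P - 1) * x)) :
    ∃ δ : ℝ → H →L[ℂ] H, IsGeodesic δ ∧ ‖deriv δ 0‖ = ‖x‖ ∧
      ∀ t : ℝ, δ t = (1 / 2 : ℂ) • (NormedSpace.exp ((2 * t) • x) * (2 * P - 1) + 1) := by
  have h2 := symmetry_of_projection hP.1
  have h3 := isSelfAdjoint_two_mul_sub_one hP.2
  set s := 2 * P - 1 with hs
  have hysm : ((2 : ℝ) • x) * s = -(s * ((2 : ℝ) • x)) := by
    rw [smul_mul_assoc, hanti, smul_neg, mul_smul_comm]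
  have hyst : star ((2 : ℝ) • x) = -((2 : ℝ) • x) := by simp [hx]
  -- The factor 2 offsets the 1/2 in δ = (c + 1)/2, so the initial speed of δ is ‖x‖.
  set y := (2 : ℝ) • x with hy
  set c : ℝ → H →L[ℂ] H := fun t => NormedSpace.exp (t • y) * s with hc
  have dc : ∀ t, HasDerivAt c (y * c t) t := hasDerivAt_exp_smul_mul y s
  have hd1 : ∀ t, HasDerivAt (fun t => (1 / 2 : ℂ) • (c t + 1)) ((1 / 2 : ℂ) • (y * c t)) t :=
    fun t => ((dc t).add_const 1).const_smul (1 / 2 : ℂ)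
  have hd2 : ∀ t, HasDerivAt (fun t => (1 / 2 : ℂ) • (y * c t)) ((1 / 2 : ℂ) • (y * (y * c t))) t :=
    fun t => ((dc t).const_mul y).const_smul (1 / 2 : ℂ)
  have e1 : deriv (fun t => (1 / 2 : ℂ) • (c t + 1)) = fun t => (1 / 2 : ℂ) • (y * c t) :=
    funext fun t => (hd1 t).deriv
  have hcc : ∀ t, c t * c t = 1 := exp_smul_mul_symmetry_mul_self hysm h2
  have hcs : ∀ t, star (c t) = c t := star_exp_smul_mul_symmetry hysm h3.star_eq hyst
  have hc2 : ∀ t, 2 * ((1 / 2 : ℂ) • (c t + 1)) - 1 = c t := fun t => by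
    rw [mul_smul_comm, two_mul, ← two_smul ℂ, smul_smul]
    norm_num
  have hidem : ∀ t, IsIdempotentElem ((1 / 2 : ℂ) • (c t + 1)) := fun t => by
    rw [IsIdempotentElem, smul_mul_smul_comm]
    have : (c t + 1) * (c t + 1) = (2 : ℂ) • (c t + 1) := by
      have e : (c t + 1) * (c t + 1) = c t * c t + 2 * c t + 1 := by noncomm_ring
      rw [e, hcc, two_smul]; noncomm_ring
    rw [this, smul_smul]; norm_num
  refine ⟨fun t => (1 / 2 : ℂ) • (c t + 1), ⟨?_, fun t => ⟨hidem t, ?_⟩, fun t => ?_⟩, ?_,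
    fun t => ?_⟩
  · exact ((contDiff_exp_smul_mul y s ∞).add contDiff_const).const_smul (1 / 2 : ℂ)
  · rw [isSelfAdjoint_iff, star_smul, star_add, hcs, star_one]
    simp
  · rw [codiagPart_eq_zero_iff (hidem t), hc2, e1, (hd2 t).deriv]
    have hyc : y * c t = -(c t * y) := by
      have a : Commute y (NormedSpace.exp (t • y)) :=
        ((Commute.refl y).smul_right t).exp_right
      simp only [hc]
      rw [← mul_assoc, a.eq, mul_assoc, hysm, mul_neg, mul_assoc]
    -- y anticommutes with c t, so y² commutes with it, and therefore so does c'' = y²c.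
    refine Commute.smul_right ?_ _
    change c t * (y * (y * c t)) = y * (y * c t) * c t
    generalize c t = g at hyc
    calc g * (y * (y * g)) = (g * y) * (y * g) := by rw [mul_assoc]
      _ = -(y * g) * (y * g) := by rw [hyc, neg_neg, mul_assoc]
      _ = y * (-(g * y)) * g := by noncomm_ring
      _ = y * (y * g) * g := by rw [← hyc]
  · rw [e1]
    have : c 0 = s := by simp [hc]
    simp only [this]
    rw [norm_smul, norm_mul_eq_of_symmetry h3 h2, hy, norm_smul]
    simp
  · simp only [hc, hy, smul_smul]
    rw [mul_comm t 2]

end Operators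

end MatchedProjection

open MatchedProjection in
theorem mainTheorem2 {H : Type*} [NormedAddCommGroup H] [InnerProductSpace ℂ H] [CompleteSpace H]
    (E : H →L[ℂ] H) (hE : IsIdempotentElem E) :
    (∃ δ : ℝ → H →L[ℂ] H,
      IsGeodesicJoining (rangeProj E hE) (rangeProj (star E) hE.star) δ ∧
      (∀ η : ℝ → H →L[ℂ] H,
        IsGeodesicJoining (rangeProj E hE) (rangeProj (star E) hE.star) η → η = δ) ∧
      δ (1 / 2) = matchedProj E hE ∧
      δ (1 / 2) = (1 / 2 : ℂ) • (unitaryPart (2 * E - 1) + 1)) ∧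
    matchedProj E hE = (1 / 2 : ℂ) • (unitaryPart (2 * E - 1) + 1) ∧
    unitaryPart (2 * E - 1) ∈ unitary (H →L[ℂ] H) ∧
    2 * E - 1 = unitaryPart (2 * E - 1) * CFC.abs (2 * E - 1) := by
  obtain ⟨r, s, hr0, hs0, hs1, hrr, hrs, hsr, hrc, hsc⟩ :=
    exists_abs_inverse (isSelfAdjoint_gap E) (one_le_gap_sq hE)
  obtain ⟨hvst, hvv⟩ := gap_mul_inverse_symmetry hE hs0 hrr hsr hsc
  have habs := abs_reflection hE hs0 hrr hsr hsc
  have hm := matchedProj_eq hE hr0 hrr hrs hsr hrc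
  have hC := symmetry_of_projection hE
  have hp := isStarProjection_rangeProj E hE
  have hpe := rangeProj_mul E hE
  have hep := mul_rangeProj E hE
  have hq := isStarProjection_rangeProj (star E) hE.star
  have hqe := rangeProj_mul (star E) hE.star
  have heq := mul_rangeProj (star E) hE.star
  obtain ⟨hw, hw1, hw2⟩ := direct_rotation_properties hE hs0 hs1 hrr hrs hsr hsc hp hpe hep
  have hvpv := symmetry_conj_rangeProj hE hrr hrs hsc hp.2 hpe hep hq.2 hqe heq
  generalize rangeProj E hE = p at *
  generalize rangeProj (star E) hE.star = q at *
  generalize (E + star E - 1) * s = v at *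
  -- |C| = vC has inverse Cv, as v² = C² = 1; hence C|C|⁻¹ = CCv = v.
  have hup : unitaryPart (2 * E - 1) = v := by
    rw [unitaryPart, habs, ring_inverse_eq_of_mul_eq_one (b := (2 * E - 1) * v),
      ← mul_assoc, hC, one_mul]
    · rw [mul_assoc, ← mul_assoc (2 * E - 1), hC, one_mul, hvv]
    · rw [mul_assoc, ← mul_assoc v, hvv, one_mul, hC]
  have h2 := symmetry_of_projection hp.1
  obtain ⟨x, hx1, hx2, hx3, hx4⟩ :=
    exists_log_of_unitary hw hw1 (isSelfAdjoint_two_mul_sub_one hp.2) h2 hw2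
  obtain ⟨δ, hδ, hδ', hδt⟩ := exists_isGeodesic hp hx1 hx4
  have hhalf : δ (1 / 2) = (1 / 2 : ℂ) • (v + 1) := by
    rw [hδt, mul_one_div_cancel two_ne_zero, one_smul, hx3, mul_assoc, h2, mul_one]
  have hproj : ∀ a : H →L[ℂ] H, (1 / 2 : ℂ) • (2 * a - 1 + 1) = a := fun a => by
    rw [sub_add_cancel, two_mul, ← two_smul ℂ, smul_smul]
    norm_num
  have hjoin : IsGeodesicJoining p q δ := by
    refine ⟨hδ, ?_, ?_, by rwa [hδ']⟩
    · rw [hδt, mul_zero, zero_smul, NormedSpace.exp_zero, one_mul, hproj]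
    -- At t = 1 the symmetry is w²(2p - 1) = v(2p - 1)v = 2vpv - 1 = 2q - 1.
    · have hexp : NormedSpace.exp ((2 : ℝ) • x) = v * (2 * p - 1) * (v * (2 * p - 1)) := by
        let _ : NormedAlgebra ℚ (H →L[ℂ] H) := .restrictScalars ℚ ℂ _
        rw [two_smul, NormedSpace.exp_add_of_commute (Commute.refl x), hx3]
      have : v * (2 * p - 1) * (v * (2 * p - 1)) * (2 * p - 1) = 2 * q - 1 := by
        rw [mul_assoc, mul_assoc v (2 * p - 1) (2 * p - 1), h2, mul_one]
        have : v * (2 * p - 1) * v = 2 * (v * p * v) - v * v := by noncomm_ring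
        rw [this, hvpv, hvv]
      rw [hδt, mul_one, hexp, this, hproj]
  rw [hup, hm, habs]
  refine ⟨⟨δ, hjoin, fun η hη => hjoin.unique hη, hhalf, hhalf⟩, rfl, ?_, ?_⟩
  · rw [Unitary.mem_iff, hvst.star_eq]
    exact ⟨hvv, hvv⟩
  · rw [← mul_assoc, hvv, one_mul]
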